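/- Let $H_0\in(0,1)$ and $K_0\in(0,1]$, and let $B^{H_0,K_0}=(B^{H_0,K_0}_t)_{t\ge 0}$ be the one-dimensional bi-fractional Brownian motion with parameters $H_0,K_0$, that is, a centered real-valued Gaussian process with covariance $$\mathbb{E}\big[B^{H_0,K_0}_sB^{H_0,K_0}_t\big]=\frac{1}{2^{K_0}}\Big[\big(s^{2H_0}+t^{2H_0}\big)^{K_0}-|t-s|^{2H_0K_0}\Big],\qquad s,t\ge 0.$$ Then $B^{H_0,K_0}$ has the strong local nondeterminism property with index $H_0K_0$: there exists a constant $\kappa_{H_0,K_0}>0$, depending only on $H_0$ and $K_0$, such that for every integer $m\ge 1$ and all times $0<s_1\le\dots\le s_m<t<\infty$, almost surely, $$\operatorname{Var}\Big(B^{H_0,K_0}_t\,\Big|\,B^{H_0,K_0}_{s_1},\dots,B^{H_0,K_0}_{s_m}\Big)\ \ge\ \kappa_{H_0,K_0}\,\min_{1\le j\le m}|t-s_j|^{2H_0K_0}.$$ -/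

import Mathlib

open MeasureTheory ProbabilityTheory
open scoped NNReal

/-- `B = (B_t)_{t ≥ 0}` is a one-dimensional bi-fractional Brownian motion with parameters `H₀`
and `K₀` under `P`: a family of real random variables which is a centered Gaussian process with
covariance
`E[B_s B_t] = 2^{-K₀} ((s^{2H₀} + t^{2H₀})^{K₀} - |t - s|^{2H₀K₀})`. -/
structure IsBifractionalBrownianMotion {Ω : Type*} [MeasurableSpace Ω]
    (H₀ K₀ : ℝ) (B : ℝ≥0 → Ω → ℝ) (P : Measure Ω) : Prop where
  measurable : ∀ t, Measurable (B t)
  isGaussianProcess : IsGaussianProcess B P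
  centered : ∀ t, ∫ ω, B t ω ∂P = 0
  covariance : ∀ s t, ∫ ω, B s ω * B t ω ∂P =
    1 / (2 : ℝ) ^ K₀ * (((s : ℝ) ^ (2 * H₀) + (t : ℝ) ^ (2 * H₀)) ^ K₀
      - |(t : ℝ) - (s : ℝ)| ^ (2 * H₀ * K₀))

/-- The σ-algebra on `Ω` generated by the random vector `(X_1, …, X_m)`. -/
abbrev sigmaGenerated {Ω : Type*} {m : ℕ} (X : Fin m → Ω → ℝ) : MeasurableSpace Ω :=
  MeasurableSpace.comap (fun ω j => X j ω) MeasurableSpace.pi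

/-! For a Gaussian process the conditional variance is almost surely the constant `E[(B_t - Σ c_j
B_{s_j})²]`, with `c` the coefficients of the `L²` projection. This is the covariance form at
weights `a` with value `1` at `t`, so it suffices to bound that form below for all such `a`.

Put `α = 2H₀`. For `K < 1`, writing `x^K` as a multiple of `∫ (1 - e^{-xu}) u^{-1-K} du` turns the
covariance into a positive mixture over `u` of `e^{-u|x-y|^α} - e^{-u(|x|^α+|y|^α)}`. This is the
kernel `e^{-u|x-y|^α}` conditioned on its value at `0`, so `0` just joins the observation points
(`mul_exp_le_sum_sum_exp_neg_sub`).

For the stationary kernel, write `|x|^α = ψ(x) + g(0) - g(x)`, with `ψ` negative definite and `g`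
positive definite, zero outside `(-2, 2)` (`exists_posSemidef_of_abs_rpow`). Then `e^{-u|x|^α} =
e^{-u g(0)} e^{-uψ(x)} e^{u g(x)}`. Keeping only the linear term of the last exponential leaves a
kernel under which a point at distance at least `2` from the others is uncorrelated with them. This
gives the bound `u g(0) e^{-u g(0)}`, which is integrated over `u`, or divided by `u → 0+` when `K =
1`. Scaling replaces `2` by any distance. -/

/-! ### Gaussian conditional variance as a quadratic form -/

theorem exists_integral_sub_sum_mul_eq_zero {Ω : Type*} [MeasurableSpace Ω] {P : Measure Ω}
    {ι : Type*} [Fintype ι] {X : Ω → ℝ} {Y : ι → Ω → ℝ} (hX : MemLp X 2 P)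
    (hY : ∀ j, MemLp (Y j) 2 P) :
    ∃ c : ι → ℝ, ∀ j, ∫ ω, (X ω - ∑ i, c i * Y i ω) * Y j ω ∂P = 0 := by
  set b : ι → Lp ℝ 2 P := fun j => (hY j).toLp (Y j)
  set U : Submodule ℝ (Lp ℝ 2 P) := Submodule.span ℝ (Set.range b)
  have : FiniteDimensional ℝ U := FiniteDimensional.span_of_finite ℝ (Set.finite_range b)
  obtain ⟨c, hc⟩ := (Submodule.mem_span_range_iff_exists_fun ℝ).1
    (Submodule.starProjection_apply_mem U (hX.toLp X))
  refine ⟨c, fun j => ?_⟩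
  have horth : inner ℝ (hX.toLp X - ∑ i, c i • b i) (b j) = 0 := by
    rw [hc]
    exact Submodule.starProjection_inner_eq_zero _ _ (Submodule.subset_span ⟨j, rfl⟩)
  have hinner : ∀ {f : Ω → ℝ} (hf : MemLp f 2 P),
      inner ℝ (hf.toLp f) (b j) = ∫ ω, f ω * Y j ω ∂P := by
    intro f hf
    rw [L2.inner_def]
    refine integral_congr_ae ?_
    filter_upwards [hf.coeFn_toLp, (hY j).coeFn_toLp] with ω h1 h2
    rw [h1, h2]
    simp [mul_comm]
  have hb : ∀ i, inner ℝ (b i) (b j) = ∫ ω, Y i ω * Y j ω ∂P := fun i => hinner (hY i)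
  simp only [inner_sub_left, sum_inner, real_inner_smul_left, hinner hX, hb] at horth
  rw [← horth]
  simp_rw [sub_mul, Finset.sum_mul, mul_assoc]
  have hint : ∀ i, Integrable (fun ω => c i * (Y i ω * Y j ω)) P :=
    fun i => ((hY i).integrable_mul (hY j)).const_mul _
  have hXY : Integrable (fun ω => X ω * Y j ω) P := hX.integrable_mul (hY j)
  rw [integral_sub hXY (integrable_finsetSum _ fun i _ => hint i),
    integral_finsetSum _ fun i _ => hint i]
  simp_rw [integral_const_mul]

/-- The projection residual is uncorrelated with the observations and jointly Gaussian with them,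
hence independent of them: conditioning does not change its second moment. -/
theorem ProbabilityTheory.IsGaussianProcess.exists_condVar_ae_eq {Ω : Type*} [mΩ : MeasurableSpace Ω]
    {P : Measure Ω} [IsProbabilityMeasure P] {T : Type*} {B : T → Ω → ℝ}
    (hB : IsGaussianProcess B P) (hmeas : ∀ t, Measurable (B t)) (hcent : ∀ t, ∫ ω, B t ω ∂P = 0)
    {m : ℕ} (s : Fin m → T) (t : T) :
    ∃ c : Fin m → ℝ, Var[B t; P | sigmaGenerated (fun j => B (s j))] =ᵐ[P]
      fun _ => ∫ ω, (B t ω - ∑ j, c j * B (s j) ω) ^ 2 ∂P := by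
  have hL2 : ∀ t, MemLp (B t) 2 P := fun t => (hB.hasGaussianLaw_eval t).memLp_two
  obtain ⟨c, hc⟩ := exists_integral_sub_sum_mul_eq_zero (hL2 t) (fun j => hL2 (s j))
  refine ⟨c, ?_⟩
  set Z : Ω → ℝ := fun ω => B t ω - ∑ j, c j * B (s j) ω with hZ
  set W : Ω → ℝ := fun ω => ∑ j, c j * B (s j) ω with hW
  have hvec : Measurable (fun ω j => B (s j) ω) := measurable_pi_lambda _ fun j => hmeas _
  have hZm : Measurable Z :=
    (hmeas t).sub (Finset.measurable_fun_sum _ fun j _ => (hmeas _).const_mul _)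
  have hWL2 : MemLp W 2 P := memLp_finsetSum _ fun j _ => (hL2 _).const_mul _
  have hZL2 : MemLp Z 2 P := (hL2 t).sub hWL2
  have hZ0 : ∫ ω, Z ω ∂P = 0 := by
    have h1 : ∫ ω, W ω ∂P = 0 := by
      simp only [hW]
      rw [integral_finsetSum _ fun j _ => ((hL2 _).integrable one_le_two).const_mul _]
      simp [integral_const_mul, hcent]
    have := integral_sub ((hL2 t).integrable one_le_two) (hWL2.integrable one_le_two)
    simp only [h1, hcent, sub_zero] at this
    exact this
  have hjoint : IsGaussianProcess (Sum.elim (fun _ : Unit => Z) (fun j => B (s j))) P := by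
    refine hB.of_isGaussianProcess ?_
    classical
    rintro (_ | j)
    · refine ⟨insert t (Finset.univ.image s),
        ContinuousLinearMap.proj ⟨t, by simp⟩ -
          ∑ j, c j • ContinuousLinearMap.proj ⟨s j, by simp⟩, fun ω => ?_⟩
      simp [hZ]
    · exact ⟨{s j}, ContinuousLinearMap.proj ⟨s j, by simp⟩, fun ω => by simp⟩
  have hindep : IndepFun Z (fun ω j => B (s j) ω) P := by
    have h := hjoint.indepFun_of_covariance_eq_zero (fun _ => hZm.aemeasurable)
      (fun j => (hmeas _).aemeasurable) (fun _ j => by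
        rw [covariance_eq_sub hZL2 (hL2 _), hZ0, zero_mul, sub_zero]
        exact hc j)
    exact h.comp (φ := fun f : Unit → ℝ => f ()) (measurable_pi_apply _) measurable_id
  have hle : sigmaGenerated (fun j => B (s j)) ≤ mΩ := hvec.comap_le
  set 𝓖 : MeasurableSpace Ω := sigmaGenerated (fun j => B (s j)) with h𝓖
  have hWG : StronglyMeasurable[𝓖] W := by
    have hf : Measurable (fun y : Fin m → ℝ => ∑ j, c j * y j) := by fun_prop
    exact (hf.comp (comap_measurable (fun ω j => B (s j) ω))).stronglyMeasurable
  have hexpZ : P[Z | 𝓖] =ᵐ[P] fun _ => 0 := by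
    have := condExp_indep_eq (μ := P) hZm.comap_le hle
      (comap_measurable Z).stronglyMeasurable hindep
    simpa only [hZ0] using this
  have hexp : P[B t | 𝓖] =ᵐ[P] W := by
    have hsum : B t = Z + W := by ext ω; simp [hZ, hW]
    have h1 := condExp_add (hZL2.integrable one_le_two) (hWL2.integrable one_le_two) 𝓖
    rw [condExp_of_stronglyMeasurable hle hWG (hWL2.integrable one_le_two), ← hsum] at h1
    filter_upwards [h1, hexpZ] with ω h1 h2
    simp [h1, h2]
  have hsq : (B t - P[B t | 𝓖]) ^ 2 =ᵐ[P] fun ω => Z ω ^ 2 := by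
    filter_upwards [hexp] with ω h
    simp [h, hZ, hW]
  refine (condExp_congr_ae hsq).trans ?_
  exact condExp_indep_eq (μ := P) hZm.comap_le hle
    ((comap_measurable Z).pow_const 2).stronglyMeasurable hindep

theorem integral_sum_mul_sq {Ω : Type*} [MeasurableSpace Ω] {P : Measure Ω}
    {ι : Type*} [Fintype ι] {Y : ι → Ω → ℝ} (hY : ∀ j, MemLp (Y j) 2 P) (a : ι → ℝ) :
    ∫ ω, (∑ i, a i * Y i ω) ^ 2 ∂P = ∑ i, ∑ j, a i * a j * ∫ ω, Y i ω * Y j ω ∂P := by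
  have hint : ∀ i j, Integrable (fun ω => a i * a j * (Y i ω * Y j ω)) P :=
    fun i j => ((hY i).integrable_mul (hY j)).const_mul _
  have hexpand : ∀ ω, (∑ i, a i * Y i ω) ^ 2 = ∑ i, ∑ j, a i * a j * (Y i ω * Y j ω) := by
    intro ω
    rw [sq, Finset.sum_mul_sum]
    exact Finset.sum_congr rfl fun i _ => Finset.sum_congr rfl fun j _ => by ring
  simp_rw [hexpand, ← integral_const_mul]
  rw [integral_finsetSum _ fun i _ => integrable_finsetSum _ fun j _ => hint i j]
  exact Finset.sum_congr rfl fun i _ => integral_finsetSum _ fun j _ => hint i j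

/-! ### Scaling and integrability against `u^(-1-β)` -/

open Set in
theorem integral_comp_mul_rpow (f : ℝ → ℝ) (β : ℝ) {x : ℝ} (hx : 0 < x) :
    ∫ u in Ioi (0 : ℝ), f (x * u) * u ^ (-1 - β) =
      x ^ β * ∫ u in Ioi (0 : ℝ), f u * u ^ (-1 - β) := by
  have h := integral_comp_mul_left_Ioi (fun u => f u * u ^ (-1 - β)) 0 hx
  rw [mul_zero, smul_eq_mul] at h
  have h2 : ∫ u in Ioi (0 : ℝ), f (x * u) * u ^ (-1 - β) =
      x ^ (1 + β) * ∫ u in Ioi (0 : ℝ), f (x * u) * (x * u) ^ (-1 - β) := by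
    rw [← integral_const_mul]
    refine setIntegral_congr_fun measurableSet_Ioi fun u (hu : 0 < u) => ?_
    rw [Real.mul_rpow hx.le hu.le]
    have : x ^ (1 + β) * x ^ (-1 - β) = 1 := by rw [← Real.rpow_add hx]; simp
    linear_combination (-(f (x * u) * u ^ (-1 - β))) * this
  rw [h2, h, ← mul_assoc, Real.rpow_add hx, Real.rpow_one]
  field_simp

open Set in
theorem integrableOn_comp_mul_rpow {f : ℝ → ℝ} {β : ℝ}
    (hf : IntegrableOn (fun u => f u * u ^ (-1 - β)) (Ioi 0)) {x : ℝ} (hx : 0 < x) :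
    IntegrableOn (fun u => f (x * u) * u ^ (-1 - β)) (Ioi 0) := by
  have h := (integrableOn_Ioi_comp_mul_left_iff (fun u => f u * u ^ (-1 - β)) 0 hx).2
    (by simpa using hf)
  refine IntegrableOn.congr_fun (h.const_mul (x ^ (1 + β))) (fun u (hu : 0 < u) => ?_) measurableSet_Ioi
  rw [Real.mul_rpow hx.le hu.le]
  have : x ^ (1 + β) * x ^ (-1 - β) = 1 := by rw [← Real.rpow_add hx]; simp
  linear_combination (f (x * u) * u ^ (-1 - β)) * this

open Set in
/-- Integrability on `(0, ∞)` from power bounds at `0` and at `∞`. -/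
theorem integrableOn_mul_rpow_of_le {f : ℝ → ℝ} {β p q A C : ℝ} (hf : Continuous f)
    (hp : β < p) (hq : q < β) (h0 : ∀ u, 0 < u → u ≤ 1 → |f u| ≤ A * u ^ p)
    (h1 : ∀ u, 1 ≤ u → |f u| ≤ C * u ^ q) :
    IntegrableOn (fun u => f u * u ^ (-1 - β)) (Ioi 0) := by
  have hm : ∀ s : Set ℝ, AEStronglyMeasurable (fun u => f u * u ^ (-1 - β)) (volume.restrict s) :=
    fun s => (hf.measurable.mul (measurable_id.pow_const _)).aestronglyMeasurable
  rw [← Ioc_union_Ioi_eq_Ioi (zero_le_one' ℝ)]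
  refine IntegrableOn.union ?_ ?_
  · have hi : IntegrableOn (fun u : ℝ => A * u ^ (p + (-1 - β))) (Ioc 0 1) := by
      refine Integrable.const_mul ?_ A
      exact (intervalIntegrable_iff_integrableOn_Ioc_of_le zero_le_one).1
        (intervalIntegral.intervalIntegrable_rpow' (by linarith))
    refine Integrable.mono' hi (hm _) ?_
    filter_upwards [ae_restrict_mem measurableSet_Ioc] with u hu
    have hpos : 0 ≤ u ^ (-1 - β) := Real.rpow_nonneg hu.1.le _
    rw [Real.norm_eq_abs, abs_mul, abs_of_nonneg hpos, Real.rpow_add hu.1, ← mul_assoc]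
    exact mul_le_mul_of_nonneg_right (h0 u hu.1 hu.2) hpos
  · have hi : IntegrableOn (fun u : ℝ => C * u ^ (q + (-1 - β))) (Ioi 1) :=
      Integrable.const_mul (integrableOn_Ioi_rpow_of_lt (by linarith) one_pos) C
    refine Integrable.mono' hi (hm _) ?_
    filter_upwards [ae_restrict_mem measurableSet_Ioi] with u (hu : 1 < u)
    have hu0 : 0 < u := by linarith
    have hpos : 0 ≤ u ^ (-1 - β) := Real.rpow_nonneg hu0.le _
    rw [Real.norm_eq_abs, abs_mul, abs_of_nonneg hpos, Real.rpow_add hu0, ← mul_assoc]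
    exact mul_le_mul_of_nonneg_right (h1 u hu.le) hpos

theorem integrableOn_one_sub_exp_neg_mul_rpow {K : ℝ} (h0 : 0 < K) (h1 : K < 1) :
    IntegrableOn (fun u : ℝ => (1 - Real.exp (-u)) * u ^ (-1 - K)) (Set.Ioi 0) := by
  refine integrableOn_mul_rpow_of_le (p := 1) (q := 0) (A := 1) (C := 1) (by fun_prop) h1 h0 ?_ ?_
  · intro u hu _
    have h1 := Real.one_sub_le_exp_neg u
    have h2 := Real.exp_le_one_iff.2 (neg_nonpos.2 hu.le)
    rw [abs_of_nonneg (by linarith), Real.rpow_one]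
    linarith
  · intro u hu
    have h2 := Real.exp_le_one_iff.2 (neg_nonpos.2 (zero_le_one.trans hu))
    have h3 := Real.exp_pos (-u)
    rw [abs_of_nonneg (by linarith), Real.rpow_zero]
    linarith

theorem integrableOn_one_sub_cos_mul_rpow {α : ℝ} (h0 : 0 < α) (h2 : α < 2) :
    IntegrableOn (fun u : ℝ => (1 - Real.cos u) * u ^ (-1 - α)) (Set.Ioi 0) := by
  refine integrableOn_mul_rpow_of_le (p := 2) (q := 0) (A := 1) (C := 2) (by fun_prop) h2 h0 ?_ ?_
  · intro u hu _
    rw [abs_of_nonneg (by linarith [Real.cos_le_one u])]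
    have := Real.one_sub_sq_div_two_le_cos (x := u)
    norm_num
    nlinarith
  · intro u hu
    rw [abs_of_nonneg (by linarith [Real.cos_le_one u]), Real.rpow_zero]
    linarith [Real.neg_one_le_cos u]

/-- Subtracting the second-order Taylor polynomial makes the cosine `O(u⁴)` at `0`, enough against
`u⁻⁴`; at infinity the remainder is only `O(u²)`. -/
theorem integrableOn_cos_remainder_mul_rpow :
    IntegrableOn (fun u : ℝ => (Real.cos u - 1 + u ^ 2 / 2) * u ^ (-1 - 3 : ℝ)) (Set.Ioi 0) := by
  refine integrableOn_mul_rpow_of_le (p := 4) (q := 2) (A := 1) (C := 1) (by fun_prop)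
    (by norm_num) (by norm_num) ?_ ?_
  · intro u hu hu1
    have h := Real.cos_bound (x := u) (by rwa [abs_of_pos hu])
    rw [abs_of_pos hu] at h
    have he : Real.cos u - 1 + u ^ 2 / 2 = Real.cos u - (1 - u ^ 2 / 2) := by ring
    rw [he, show u ^ (4 : ℝ) = u ^ 4 by norm_cast]
    nlinarith [pow_pos hu 4]
  · intro u hu
    have := Real.one_sub_sq_div_two_le_cos (x := u)
    rw [abs_of_nonneg (by linarith), show u ^ (2 : ℝ) = u ^ 2 by norm_cast]
    nlinarith [Real.cos_le_one u]

theorem integrableOn_cos_mul_sq_mul_rpow (x : ℝ) :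
    IntegrableOn (fun u : ℝ => Real.cos (x * u) * (1 - Real.cos u) ^ 2 * u ^ (-1 - 3 : ℝ))
      (Set.Ioi 0) := by
  have hb : ∀ u, |Real.cos (x * u) * (1 - Real.cos u) ^ 2| ≤ (1 - Real.cos u) ^ 2 := by
    intro u
    rw [abs_mul, abs_of_nonneg (sq_nonneg (1 - Real.cos u))]
    exact mul_le_of_le_one_left (sq_nonneg _) (Real.abs_cos_le_one _)
  refine integrableOn_mul_rpow_of_le (p := 4) (q := 0) (A := 1) (C := 4) (by fun_prop)
    (by norm_num) (by norm_num) ?_ ?_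
  · intro u hu _
    refine (hb u).trans ?_
    have := Real.one_sub_sq_div_two_le_cos (x := u)
    have h2 := Real.cos_le_one u
    rw [show u ^ (4 : ℝ) = u ^ 4 by norm_cast]
    nlinarith [sq_nonneg u]
  · intro u hu
    refine (hb u).trans ?_
    rw [Real.rpow_zero]
    nlinarith [Real.cos_le_one u, Real.neg_one_le_cos u]

/-- This domination lets a multiple of the density of `g` be subtracted from that of `|x|^α` while
keeping it nonnegative. -/
theorem one_sub_cos_sq_mul_rpow_le {α u : ℝ} (h0 : 0 < α) (h2 : α < 2) (hu : 0 < u) :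
    (1 - Real.cos u) ^ 2 * u ^ (-1 - 3 : ℝ) ≤ 4 * u ^ (-1 - α) := by
  have hc := Real.one_sub_sq_div_two_le_cos (x := u)
  have hc1 := Real.cos_le_one u
  have hc2 := Real.neg_one_le_cos u
  have hp : 0 < u ^ (-1 - 3 : ℝ) := Real.rpow_pos_of_pos hu _
  rcases le_total u 1 with h | h
  · have h1 : (1 : ℝ) ≤ u ^ (-1 - α) := Real.one_le_rpow_of_pos_of_le_one_of_nonpos hu h (by linarith)
    have h3 : u ^ 4 * u ^ (-1 - 3 : ℝ) = 1 := by
      rw [← Real.rpow_natCast, ← Real.rpow_add hu]; norm_num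
    have h4 : (1 - Real.cos u) ^ 2 ≤ u ^ 4 := by nlinarith [sq_nonneg u]
    nlinarith [mul_le_mul_of_nonneg_right h4 hp.le]
  · have h1 : u ^ (-1 - 3 : ℝ) ≤ u ^ (-1 - α) :=
      Real.rpow_le_rpow_of_exponent_le h (by linarith)
    have h4 : (1 - Real.cos u) ^ 2 ≤ 4 := by nlinarith
    nlinarith [mul_le_mul_of_nonneg_right h4 hp.le]

/-- A function on `(0, ∞)` that is nonnegative, continuous and not identically zero has a
positive integral. -/
theorem setIntegral_Ioi_pos {f : ℝ → ℝ} (hf : IntegrableOn f (Set.Ioi 0))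
    (h0 : ∀ u, 0 < u → 0 ≤ f u) (h1 : ∀ u ∈ Set.Ioo (1 : ℝ) 2, 0 < f u) :
    0 < ∫ u in Set.Ioi (0 : ℝ), f u := by
  rw [setIntegral_pos_iff_support_of_nonneg_ae
    ((ae_restrict_iff' measurableSet_Ioi).2 (.of_forall h0)) hf]
  refine lt_of_lt_of_le ?_ (measure_mono (s := Set.Ioo (1 : ℝ) 2) fun u hu =>
    ⟨(h1 u hu).ne', Set.mem_Ioi.2 (by linarith [hu.1])⟩)
  simp

theorem one_sub_cos_pos {u : ℝ} (hu : u ∈ Set.Ioo (1 : ℝ) 2) : 0 < 1 - Real.cos u := by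
  have := Real.cos_lt_cos_of_nonneg_of_le_pi le_rfl (by linarith [Real.pi_gt_three, hu.2])
    (show (0 : ℝ) < u by linarith [hu.1])
  rw [Real.cos_zero] at this
  linarith

/-! ### Integral representations of powers -/

theorem integral_one_sub_exp_neg_mul {K : ℝ} (h0 : 0 < K) {x : ℝ} (hx : 0 ≤ x) :
    ∫ u in Set.Ioi (0 : ℝ), (1 - Real.exp (-(x * u))) * u ^ (-1 - K) =
      x ^ K * ∫ u in Set.Ioi (0 : ℝ), (1 - Real.exp (-u)) * u ^ (-1 - K) := by
  rcases hx.eq_or_lt with rfl | hx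
  · simp [Real.zero_rpow h0.ne']
  · exact integral_comp_mul_rpow (fun u => 1 - Real.exp (-u)) K hx

theorem integrableOn_one_sub_exp_neg_mul {K : ℝ} (h0 : 0 < K) (h1 : K < 1) {x : ℝ} (hx : 0 ≤ x) :
    IntegrableOn (fun u : ℝ => (1 - Real.exp (-(x * u))) * u ^ (-1 - K)) (Set.Ioi 0) := by
  rcases hx.eq_or_lt with rfl | hx
  · simp
  · exact integrableOn_comp_mul_rpow (f := fun u => 1 - Real.exp (-u))
      (integrableOn_one_sub_exp_neg_mul_rpow h0 h1) hx

theorem integral_even_comp_mul_rpow {f : ℝ → ℝ} (hf : ∀ u, f (-u) = f u) (hf0 : f 0 = 0) {β : ℝ}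
    (hβ : 0 < β) (x : ℝ) :
    ∫ u in Set.Ioi (0 : ℝ), f (x * u) * u ^ (-1 - β) =
      |x| ^ β * ∫ u in Set.Ioi (0 : ℝ), f u * u ^ (-1 - β) := by
  rcases eq_or_ne x 0 with rfl | hx
  · simp [Real.zero_rpow hβ.ne', hf0]
  · rw [← integral_comp_mul_rpow f β (abs_pos.2 hx)]
    rcases abs_choice x with h | h <;> simp [h, hf]

theorem integrableOn_even_comp_mul_rpow {f : ℝ → ℝ} (hf : ∀ u, f (-u) = f u) (hf0 : f 0 = 0) {β : ℝ}
    (hi : IntegrableOn (fun u => f u * u ^ (-1 - β)) (Set.Ioi 0)) (x : ℝ) :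
    IntegrableOn (fun u => f (x * u) * u ^ (-1 - β)) (Set.Ioi 0) := by
  rcases eq_or_ne x 0 with rfl | hx
  · simp [hf0]
  · have := integrableOn_comp_mul_rpow hi (abs_pos.2 hx)
    rcases abs_choice x with h | h <;> simpa [h, hf] using this

/-! ### A compactly supported positive definite function -/

theorem cos_mul_one_sub_cos_sq (x u : ℝ) :
    Real.cos (x * u) * (1 - Real.cos u) ^ 2 =
      3 / 2 * Real.cos (x * u) - Real.cos ((x + 1) * u) - Real.cos ((x - 1) * u)
        + 1 / 4 * Real.cos ((x + 2) * u) + 1 / 4 * Real.cos ((x - 2) * u) := by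
  have e1 : (x + 1) * u = x * u + u := by ring
  have e2 : (x - 1) * u = x * u - u := by ring
  have e3 : (x + 2) * u = x * u + 2 * u := by ring
  have e4 : (x - 2) * u = x * u - 2 * u := by ring
  rw [e1, e2, e3, e4, Real.cos_add, Real.cos_sub, Real.cos_add, Real.cos_sub, Real.cos_two_mul]
  ring

/-- The function with spectral density proportional to `(1 - cos u)² / u⁴`, a fourth difference of
`|x|³`, vanishes outside `(-2, 2)`. -/
theorem integral_cos_mul_sq_eq_zero {x : ℝ} (hx : 2 ≤ |x|) :
    ∫ u in Set.Ioi (0 : ℝ), Real.cos (x * u) * (1 - Real.cos u) ^ 2 * u ^ (-1 - 3 : ℝ) = 0 := by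
  set F : ℝ → ℝ := fun u => Real.cos u - 1 + u ^ 2 / 2 with hF
  have hFe : ∀ u, F (-u) = F u := fun u => by simp [hF]
  have hF0 : F 0 = 0 := by simp [hF]
  have hI := integrableOn_even_comp_mul_rpow hFe hF0 integrableOn_cos_remainder_mul_rpow
  have hE := integral_even_comp_mul_rpow hFe hF0 (β := 3) (by norm_num)
  set D := ∫ u in Set.Ioi (0 : ℝ), F u * u ^ (-1 - 3 : ℝ)
  have key : ∫ u in Set.Ioi (0 : ℝ), Real.cos (x * u) * (1 - Real.cos u) ^ 2 * u ^ (-1 - 3 : ℝ) =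
      3 / 2 * (|x| ^ (3 : ℝ) * D) - |x + 1| ^ (3 : ℝ) * D - |x - 1| ^ (3 : ℝ) * D
        + 1 / 4 * (|x + 2| ^ (3 : ℝ) * D) + 1 / 4 * (|x - 2| ^ (3 : ℝ) * D) := by
    -- These fourth-difference weights annihilate constants and squares, so each cosine may be
    -- replaced by its remainder `F`. For `|x| ≥ 2` all five nodes lie weakly on one side of `0`,
    -- where `|·|³` is a cubic polynomial and is annihilated too.
    have hsum := integral_finsetSum (μ := volume.restrict (Set.Ioi (0 : ℝ))) (Finset.univ : Finset (Fin 5))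
      fun k _ => (hI (![x, x + 1, x - 1, x + 2, x - 2] k)).const_mul
        (![3 / 2, -1, -1, 1 / 4, 1 / 4] k)
    simp only [integral_const_mul, hE] at hsum
    refine Eq.trans ?_ (hsum.trans ?_)
    · congr 1
      ext u
      rw [cos_mul_one_sub_cos_sq]
      simp [Fin.sum_univ_five, hF]
      ring
    · simp [Fin.sum_univ_five]
      ring
  have h3 : ∀ y : ℝ, y ^ (3 : ℝ) = y ^ 3 := fun y => by norm_cast
  rw [key]
  simp only [h3]
  rcases le_total 0 x with h | h
  · rw [abs_of_nonneg h] at hx ⊢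
    rw [abs_of_nonneg (show 0 ≤ x + 1 by linarith), abs_of_nonneg (show 0 ≤ x - 1 by linarith),
      abs_of_nonneg (show 0 ≤ x + 2 by linarith), abs_of_nonneg (show 0 ≤ x - 2 by linarith)]
    ring
  · rw [abs_of_nonpos h] at hx ⊢
    rw [abs_of_nonpos (show x + 1 ≤ 0 by linarith), abs_of_nonpos (show x - 1 ≤ 0 by linarith),
      abs_of_nonpos (show x + 2 ≤ 0 by linarith), abs_of_nonpos (show x - 2 ≤ 0 by linarith)]
    ring

/-! ### Positive semidefinite kernels -/

theorem Matrix.posSemidef_iff_sum_sum_nonneg {ι : Type*} [Fintype ι] {M : Matrix ι ι ℝ}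
    (hM : ∀ i j, M j i = M i j) :
    M.PosSemidef ↔ ∀ a : ι → ℝ, 0 ≤ ∑ i, ∑ j, a i * a j * M i j := by
  rw [Matrix.posSemidef_iff_dotProduct_mulVec, and_iff_right (Matrix.IsHermitian.ext fun i j => by
    simpa using hM i j)]
  refine forall_congr' fun a => ?_
  simp only [dotProduct, Matrix.mulVec, Finset.mul_sum, Pi.star_apply, star_trivial]
  refine iff_of_eq (congrArg _ (Finset.sum_congr rfl fun i _ => Finset.sum_congr rfl fun j _ => ?_))
  ring

theorem Matrix.PosSemidef.sum_sum_nonneg {ι : Type*} [Fintype ι] {M : Matrix ι ι ℝ}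
    (hM : M.PosSemidef) (a : ι → ℝ) : 0 ≤ ∑ i, ∑ j, a i * a j * M i j :=
  (Matrix.posSemidef_iff_sum_sum_nonneg fun i j => by simpa using hM.1.apply i j).1 hM a

/-- The form is the integral of `((Σ a_i p_i)² + (Σ a_i q_i)²) w`. -/
theorem Matrix.posSemidef_of_eq_integral {ι : Type*} [Fintype ι] {M : Matrix ι ι ℝ}
    {w : ℝ → ℝ} {p q : ι → ℝ → ℝ} (hw : ∀ u, 0 < u → 0 ≤ w u)
    (hint : ∀ i j, IntegrableOn (fun u => (p i u * p j u + q i u * q j u) * w u) (Set.Ioi 0))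
    (hM : ∀ i j, M i j = ∫ u in Set.Ioi (0 : ℝ), (p i u * p j u + q i u * q j u) * w u) :
    M.PosSemidef := by
  refine (Matrix.posSemidef_iff_sum_sum_nonneg fun i j => ?_).2 fun a => ?_
  · rw [hM, hM]
    simp only [mul_comm (p j _), mul_comm (q j _)]
  · have : ∑ i, ∑ j, a i * a j * M i j = ∫ u in Set.Ioi (0 : ℝ),
        ∑ i, ∑ j, a i * a j * ((p i u * p j u + q i u * q j u) * w u) := by
      rw [integral_finsetSum _ fun i _ => integrable_finsetSum _ fun j _ =>
        (hint i j).const_mul _]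
      refine Finset.sum_congr rfl fun i _ => ?_
      rw [integral_finsetSum _ fun j _ => (hint i j).const_mul _]
      refine Finset.sum_congr rfl fun j _ => ?_
      rw [integral_const_mul, hM]
    rw [this]
    refine setIntegral_nonneg measurableSet_Ioi fun u hu => ?_
    have h : ∑ i, ∑ j, a i * a j * ((p i u * p j u + q i u * q j u) * w u) =
        ((∑ i, a i * p i u) ^ 2 + (∑ i, a i * q i u) ^ 2) * w u := by
      simp_rw [sq, Finset.sum_mul_sum, ← Finset.sum_add_distrib, Finset.sum_mul]
      exact Finset.sum_congr rfl fun i _ => Finset.sum_congr rfl fun j _ => by ring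
    rw [h]
    exact mul_nonneg (by positivity) (hw u hu)

/-- The quadratic form of a positive semidefinite matrix is bounded below by the contribution of
an index that is uncorrelated with all the others. -/
theorem Matrix.PosSemidef.mul_sq_le_sum_sum {J : Type*} [Fintype J]
    {M : Matrix (Option J) (Option J) ℝ} (hM : M.PosSemidef) (h0 : ∀ j, M none (some j) = 0)
    (a : Option J → ℝ) : M none none * a none ^ 2 ≤ ∑ i, ∑ j, a i * a j * M i j := by
  have h1 : ∀ j, M (some j) none = 0 := fun j => by
    rw [← h0 j]; simpa using hM.1.apply none (some j)
  have h := hM.sum_sum_nonneg fun i => i.elim 0 fun j => a (some j)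
  simp only [Fintype.sum_option, Option.elim, h0, h1, mul_zero, zero_mul,
    Finset.sum_const_zero, add_zero, zero_add] at h ⊢
  nlinarith

/-- A weighted entrywise exponential dominates each term of its power series. -/
theorem Matrix.PosSemidef.sum_sum_pow_le_exp {ι : Type*} [Fintype ι] {W A : Matrix ι ι ℝ}
    (hW : W.PosSemidef) (hA : A.PosSemidef) (a : ι → ℝ) (n : ℕ) :
    ∑ i, ∑ j, a i * a j * (W i j * (A i j ^ n / n.factorial)) ≤
      ∑ i, ∑ j, a i * a j * (W i j * Real.exp (A i j)) := by
  have hpow : ∀ n : ℕ, (Matrix.of fun i j => W i j * A i j ^ n).PosSemidef := by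
    intro n
    induction n with
    | zero =>
      have e : (Matrix.of fun i j => W i j * A i j ^ 0) = W := by ext; simp
      rwa [e]
    | succ n ih =>
      have e : (Matrix.of fun i j => W i j * A i j ^ (n + 1)) =
          (Matrix.of fun i j => W i j * A i j ^ n).hadamard A := by
        ext i j
        simp [pow_succ, mul_assoc]
      rw [e]
      exact ih.hadamard hA
  have hterm : ∀ n : ℕ, 0 ≤ ∑ i, ∑ j, a i * a j * (W i j * (A i j ^ n / n.factorial)) := by
    intro n
    have h := mul_nonneg ((hpow n).sum_sum_nonneg a) (inv_nonneg.2 (Nat.cast_nonneg n.factorial))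
    rw [Finset.sum_mul] at h
    refine h.trans_eq (Finset.sum_congr rfl fun i _ => ?_)
    rw [Finset.sum_mul]
    refine Finset.sum_congr rfl fun j _ => ?_
    rw [Matrix.of_apply]
    ring
  have hsum : HasSum (fun n : ℕ => ∑ i, ∑ j, a i * a j * (W i j * (A i j ^ n / n.factorial)))
      (∑ i, ∑ j, a i * a j * (W i j * Real.exp (A i j))) := by
    refine hasSum_sum fun i _ => hasSum_sum fun j _ => HasSum.mul_left _ (HasSum.mul_left _ ?_)
    rw [Real.exp_eq_exp_ℝ]
    exact NormedSpace.expSeries_div_hasSum_exp (A i j)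
  exact le_hasSum hsum n fun k _ => hterm k

/-- Schoenberg: the exponential of a conditionally negative definite kernel is positive
semidefinite. -/
theorem Matrix.posSemidef_exp_neg {ι : Type*} [Fintype ι] {N : Matrix ι ι ℝ} {v : ι → ℝ}
    (hN : (Matrix.of fun i j => v i + v j - N i j).PosSemidef) :
    (Matrix.of fun i j => Real.exp (-N i j)).PosSemidef := by
  have hsymm : ∀ i j, N j i = N i j := fun i j => by
    have := hN.1.apply i j
    simp only [Matrix.of_apply, star_trivial] at this
    linarith
  refine (Matrix.posSemidef_iff_sum_sum_nonneg fun i j => by simp [hsymm i j]).2 fun a => ?_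
  have hone : (Matrix.of fun _ _ : ι => (1 : ℝ)).PosSemidef := by
    refine (Matrix.posSemidef_iff_sum_sum_nonneg fun i j => rfl).2 fun b => ?_
    simp only [Matrix.of_apply, mul_one, ← Finset.sum_mul_sum]
    exact mul_self_nonneg _
  -- The weights `e^{-v_i}` cancel the `v` terms in the exponent; the term of order `0` is a square.
  have h := hone.sum_sum_pow_le_exp hN (fun i => a i * Real.exp (-v i)) 0
  refine le_trans ?_ (h.trans_eq ?_)
  · simp only [Matrix.of_apply, mul_one, pow_zero, Nat.factorial_zero, Nat.cast_one, div_one,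
      ← Finset.sum_mul_sum]
    exact mul_self_nonneg _
  · refine Finset.sum_congr rfl fun i _ => Finset.sum_congr rfl fun j _ => ?_
    simp only [Matrix.of_apply, one_mul]
    rw [show -N i j = -v i + -v j + (v i + v j - N i j) by ring, Real.exp_add, Real.exp_add]
    ring

/-! ### Local nondeterminism of the kernels -/

/-- `|x|^α` splits as the sum of a continuous negative definite function and `g 0 - g x`, where `g`
is positive definite and vanishes outside `(-2, 2)`. -/
theorem exists_posSemidef_of_abs_rpow {α : ℝ} (h0 : 0 < α) (h2 : α < 2) :
    ∃ g : ℝ → ℝ, 0 < g 0 ∧ (∀ x, 2 ≤ |x| → g x = 0) ∧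
      ∀ (ι : Type) [Fintype ι] (x : ι → ℝ),
        (Matrix.of fun i j => g (x i - x j)).PosSemidef ∧
        (Matrix.of fun i j => (|x i| ^ α - (g 0 - g (x i))) + (|x j| ^ α - (g 0 - g (x j)))
          - (|x i - x j| ^ α - (g 0 - g (x i - x j)))).PosSemidef := by
  set C : ℝ := ∫ u in Set.Ioi (0 : ℝ), (1 - Real.cos u) * u ^ (-1 - α) with hC
  have hCpos : 0 < C := by
    refine setIntegral_Ioi_pos (integrableOn_one_sub_cos_mul_rpow h0 h2) (fun u hu => ?_)
      fun u hu => ?_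
    · exact mul_nonneg (by linarith [Real.cos_le_one u]) (Real.rpow_nonneg hu.le _)
    · exact mul_pos (one_sub_cos_pos hu) (Real.rpow_pos_of_pos (by linarith [hu.1]) _)
  -- `h` is the spectral density of `g`; the factor `4 * C` keeps it below `C⁻¹ u^(-1-α)`, the
  -- density of `|x|^α`.
  set h : ℝ → ℝ := fun u => (4 * C)⁻¹ * ((1 - Real.cos u) ^ 2 * u ^ (-1 - 3 : ℝ)) with hh
  have hhnn : ∀ u, 0 < u → 0 ≤ h u := fun u hu =>
    mul_nonneg (by positivity) (mul_nonneg (sq_nonneg _) (Real.rpow_nonneg hu.le _))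
  set w : ℝ → ℝ := fun u => C⁻¹ * u ^ (-1 - α) - h u with hw
  have hwnn : ∀ u, 0 < u → 0 ≤ w u := by
    intro u hu
    have h1 := mul_le_mul_of_nonneg_left (one_sub_cos_sq_mul_rpow_le h0 h2 hu)
      (inv_nonneg.2 (show 0 ≤ 4 * C by positivity))
    have h3 : (4 * C)⁻¹ * (4 * u ^ (-1 - α)) = C⁻¹ * u ^ (-1 - α) := by
      field_simp
    simp only [hw, hh]
    linarith
  have hint : ∀ x, IntegrableOn (fun u => Real.cos (x * u) * h u) (Set.Ioi 0) := by
    intro x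
    refine ((integrableOn_cos_mul_sq_mul_rpow x).const_mul (4 * C)⁻¹).congr
      (.of_forall fun u => ?_)
    simp only [hh]; ring
  have hint0 : IntegrableOn h (Set.Ioi 0) := by simpa using hint 0
  have hintα : ∀ x, IntegrableOn (fun u => (1 - Real.cos (x * u)) * u ^ (-1 - α)) (Set.Ioi 0) :=
    integrableOn_even_comp_mul_rpow (f := fun u => 1 - Real.cos u) (by simp) (by simp)
      (integrableOn_one_sub_cos_mul_rpow h0 h2)
  have hα : ∀ x, ∫ u in Set.Ioi (0 : ℝ), (1 - Real.cos (x * u)) * u ^ (-1 - α) = |x| ^ α * C :=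
    integral_even_comp_mul_rpow (f := fun u => 1 - Real.cos u) (by simp) (by simp) h0
  set g : ℝ → ℝ := fun x => ∫ u in Set.Ioi (0 : ℝ), Real.cos (x * u) * h u with hg
  have hintw : ∀ x, IntegrableOn (fun u => (1 - Real.cos (x * u)) * w u) (Set.Ioi 0) := by
    intro x
    refine (((hintα x).const_mul C⁻¹).sub (hint0.sub (hint x))).congr (.of_forall fun u => ?_)
    simp only [hw, Pi.sub_apply]; ring
  have hwint : ∀ x, ∫ u in Set.Ioi (0 : ℝ), (1 - Real.cos (x * u)) * w u =
      |x| ^ α - (g 0 - g x) := by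
    intro x
    have e : ∀ u, (1 - Real.cos (x * u)) * w u =
        C⁻¹ * ((1 - Real.cos (x * u)) * u ^ (-1 - α)) - (h u - Real.cos (x * u) * h u) := by
      intro u; simp only [hw]; ring
    have hdiff : IntegrableOn (fun u => h u - Real.cos (x * u) * h u) (Set.Ioi 0) :=
      hint0.sub (hint x)
    simp_rw [e]
    rw [integral_sub ((hintα x).const_mul C⁻¹) hdiff, integral_sub hint0 (hint x),
      integral_const_mul, hα]
    simp only [hg, zero_mul, Real.cos_zero, one_mul]
    field_simp
  refine ⟨g, ?_, fun x hx => ?_, fun ι _ x => ⟨?_, ?_⟩⟩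
  · simp only [hg, zero_mul, Real.cos_zero, one_mul]
    refine setIntegral_Ioi_pos hint0 hhnn fun u hu => ?_
    exact mul_pos (by positivity) (mul_pos (pow_pos (one_sub_cos_pos hu) 2)
      (Real.rpow_pos_of_pos (by linarith [hu.1]) _))
  · have e : ∀ u, Real.cos (x * u) * h u =
        (4 * C)⁻¹ * (Real.cos (x * u) * (1 - Real.cos u) ^ 2 * u ^ (-1 - 3 : ℝ)) := by
      intro u; simp only [hh]; ring
    simp only [hg]
    simp_rw [e]
    rw [integral_const_mul, integral_cos_mul_sq_eq_zero hx, mul_zero]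
  · have e : ∀ i j u, Real.cos ((x i - x j) * u) * h u =
        (Real.cos (x i * u) * Real.cos (x j * u) + Real.sin (x i * u) * Real.sin (x j * u)) * h u := by
      intro i j u
      rw [sub_mul, Real.cos_sub]
    refine Matrix.posSemidef_of_eq_integral (w := h) (p := fun i u => Real.cos (x i * u))
      (q := fun i u => Real.sin (x i * u)) hhnn (fun i j => ?_) fun i j => ?_
    · simpa only [e] using hint (x i - x j)
    · simp only [Matrix.of_apply, hg, e]
  · have e : ∀ i j u, (1 - Real.cos (x i * u)) * w u + (1 - Real.cos (x j * u)) * w u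
        - (1 - Real.cos ((x i - x j) * u)) * w u =
        ((1 - Real.cos (x i * u)) * (1 - Real.cos (x j * u))
          + Real.sin (x i * u) * Real.sin (x j * u)) * w u := by
      intro i j u
      rw [sub_mul (x i), Real.cos_sub]
      ring
    refine Matrix.posSemidef_of_eq_integral (w := w) (p := fun i u => 1 - Real.cos (x i * u))
      (q := fun i u => Real.sin (x i * u)) hwnn (fun i j => ?_) fun i j => ?_
    · simpa only [← e] using! ((hintw (x i)).add (hintw (x j))).sub (hintw (x i - x j))
    · have hsum : IntegrableOn (fun u => (1 - Real.cos (x i * u)) * w u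
          + (1 - Real.cos (x j * u)) * w u) (Set.Ioi 0) := (hintw (x i)).add (hintw (x j))
      simp only [← e]
      rw [integral_sub hsum (hintw (x i - x j)),
        integral_add (hintw (x i)) (hintw (x j)), hwint, hwint, hwint]
      rfl

/-- Local nondeterminism of the stationary kernel `exp (-u |x - y|^α)`, at a point at distance at
least `2` from all the others. -/
theorem mul_exp_le_sum_sum_exp_neg {α c : ℝ} (h0 : 0 < α) {g : ℝ → ℝ}
    (hgs : ∀ x, 2 ≤ |x| → g x = 0) {J : Type} [Fintype J] {x : Option J → ℝ}
    (hg : (Matrix.of fun i j => g (x i - x j)).PosSemidef)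
    (hψ : (Matrix.of fun i j => (|x i| ^ α - (g 0 - g (x i))) + (|x j| ^ α - (g 0 - g (x j)))
          - (|x i - x j| ^ α - (g 0 - g (x i - x j)))).PosSemidef)
    (hx : ∀ j, 2 ≤ |x none - x (some j)|) {u : ℝ} (hu : 0 ≤ u) (a : Option J → ℝ)
    (ha : a none = c) :
    u * g 0 * Real.exp (-(u * g 0)) * c ^ 2 ≤
      ∑ i, ∑ j, a i * a j * Real.exp (-(u * |x i - x j| ^ α)) := by
  have hW : (Matrix.of fun i j =>
      Real.exp (-(u * (|x i - x j| ^ α - (g 0 - g (x i - x j)))))).PosSemidef := by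
    refine Matrix.posSemidef_exp_neg
      (N := Matrix.of fun i j => u * (|x i - x j| ^ α - (g 0 - g (x i - x j))))
      (v := fun i => u * (|x i| ^ α - (g 0 - g (x i)))) ?_
    convert hψ.smul hu using 1
    ext i j
    simp
    ring
  have hA : (Matrix.of fun i j => u * g (x i - x j)).PosSemidef := by
    have e : (Matrix.of fun i j => u * g (x i - x j)) =
        u • Matrix.of fun i j => g (x i - x j) := by ext; simp
    rw [e]
    exact hg.smul hu
  -- Order `1` is where `g` enters as a factor and decouples the isolated point.
  have h1 := hW.sum_sum_pow_le_exp hA a 1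
  have h2 := (hW.hadamard hA).mul_sq_le_sum_sum (fun j => by simp [hgs _ (hx j)]) a
  simp only [Matrix.hadamard_apply, Matrix.of_apply, sub_self, abs_zero, Real.zero_rpow h0.ne',
    mul_zero, neg_zero, Real.exp_zero, one_mul, ha] at h2
  simp only [Matrix.of_apply, pow_one, Nat.factorial_one, Nat.cast_one, div_one] at h1
  have h3 := mul_le_mul_of_nonneg_left (h2.trans h1) (Real.exp_pos (-(u * g 0))).le
  refine le_trans (le_of_eq (by ring)) (h3.trans_eq ?_)
  rw [Finset.mul_sum]
  refine Finset.sum_congr rfl fun i _ => ?_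
  rw [Finset.mul_sum]
  refine Finset.sum_congr rfl fun j _ => ?_
  rw [← Real.exp_add, mul_left_comm, ← Real.exp_add]
  congr 2
  ring

/-- The stationary kernel `exp (-u |x - y|^α)` conditioned at `0` still has a lower bound at a point
at distance at least `2` from `0` and from all the others. -/
theorem mul_exp_le_sum_sum_exp_neg_sub {α : ℝ} (h0 : 0 < α) {g : ℝ → ℝ}
    (hgs : ∀ x, 2 ≤ |x| → g x = 0)
    (hg : ∀ (ι : Type) [Fintype ι] (x : ι → ℝ), (Matrix.of fun i j => g (x i - x j)).PosSemidef ∧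
      (Matrix.of fun i j => (|x i| ^ α - (g 0 - g (x i))) + (|x j| ^ α - (g 0 - g (x j)))
          - (|x i - x j| ^ α - (g 0 - g (x i - x j)))).PosSemidef)
    {J : Type} [Fintype J] {x : Option J → ℝ} (hx : ∀ j, 2 ≤ |x none - x (some j)|)
    (hx0 : 2 ≤ |x none|) {u : ℝ} (hu : 0 ≤ u) {a : Option J → ℝ} (ha : a none = 1) :
    u * g 0 * Real.exp (-(u * g 0)) ≤
      ∑ i, ∑ j, a i * a j * (Real.exp (-(|x i - x j| ^ α * u))
        - Real.exp (-((|x i| ^ α + |x j| ^ α) * u))) := by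
  set S : Option J → ℝ := fun i => Real.exp (-(u * |x i| ^ α)) with hS
  -- The minimizing weight at the added point `0`: the enlarged form equals the original one minus
  -- `b₀ ^ 2`, which is the conditioned form.
  set b₀ : ℝ := -∑ i, a i * S i with hb₀
  set y : Option (Option J) → ℝ := fun i => i.elim (x none) fun i => i.elim 0 fun j => x (some j)
    with hy
  set b : Option (Option J) → ℝ := fun i => i.elim (a none) fun i => i.elim b₀ fun j => a (some j)
    with hb
  have h := mul_exp_le_sum_sum_exp_neg h0 hgs (hg _ y).1 (hg _ y).2
    (by rintro (_ | j); exacts [by simpa [hy] using hx0, by simpa [hy] using hx j]) hu b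
    (show b none = 1 from ha)
  rw [one_pow, mul_one] at h
  refine h.trans_eq ?_
  have hR : ∑ i, ∑ j, a i * a j * (Real.exp (-(|x i - x j| ^ α * u))
        - Real.exp (-((|x i| ^ α + |x j| ^ α) * u))) =
      ∑ i, ∑ j, a i * a j * Real.exp (-(u * |x i - x j| ^ α)) - b₀ ^ 2 := by
    rw [hb₀, neg_sq, sq, Finset.sum_mul_sum, ← Finset.sum_sub_distrib]
    refine Finset.sum_congr rfl fun i _ => ?_
    rw [← Finset.sum_sub_distrib]
    refine Finset.sum_congr rfl fun j _ => ?_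
    simp only [hS]
    rw [show -((|x i| ^ α + |x j| ^ α) * u) = -(u * |x i| ^ α) + -(u * |x j| ^ α) by ring,
      Real.exp_add, mul_comm _ u]
    ring
  rw [hR]
  have hsplit : b₀ = -(a none * S none + ∑ j, a (some j) * S (some j)) := by
    rw [hb₀, Fintype.sum_option]
  have e1 : ∀ z : ℝ, Real.exp (-(u * |0 - z| ^ α)) = Real.exp (-(u * |z| ^ α)) := fun z => by simp
  have e2 : ∀ z : ℝ, Real.exp (-(u * |z - 0| ^ α)) = Real.exp (-(u * |z| ^ α)) := fun z => by simp
  have e3 : Real.exp (-(u * |(0 : ℝ)| ^ α)) = 1 := by simp [Real.zero_rpow h0.ne']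
  have e4 : ∑ j, b₀ * a (some j) * S (some j) = b₀ * ∑ j, a (some j) * S (some j) := by
    rw [Finset.mul_sum]; exact Finset.sum_congr rfl fun j _ => by ring
  have e5 : ∑ j, a (some j) * b₀ * S (some j) = b₀ * ∑ j, a (some j) * S (some j) := by
    rw [Finset.mul_sum]; exact Finset.sum_congr rfl fun j _ => by ring
  simp only [Fintype.sum_option, hb, hy, Option.elim, e1, e2, e3, Finset.sum_add_distrib]
  simp only [hS] at e4 e5 hsplit
  rw [e4, e5]
  set V := ∑ j, a (some j) * Real.exp (-(u * |x (some j)| ^ α))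
  linear_combination (-2 * b₀) * (-hsplit)

theorem exists_le_sum_sum_of_two_le {α K : ℝ} (hα0 : 0 < α) (hα2 : α < 2) (hK0 : 0 < K)
    (hK1 : K ≤ 1) :
    ∃ κ : ℝ, 0 < κ ∧ ∀ (J : Type) [Fintype J] (x a : Option J → ℝ),
      (∀ j, 2 ≤ |x none - x (some j)|) → 2 ≤ |x none| → a none = 1 →
      κ ≤ ∑ i, ∑ j, a i * a j * ((|x i| ^ α + |x j| ^ α) ^ K - |x i - x j| ^ (α * K)) := by
  obtain ⟨g, hg0, hgs, hg⟩ := exists_posSemidef_of_abs_rpow hα0 hα2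
  rcases hK1.lt_or_eq with hK1 | rfl
  · set C : ℝ := ∫ u in Set.Ioi (0 : ℝ), (1 - Real.exp (-u)) * u ^ (-1 - K)
    have hC : 0 < C := by
      refine setIntegral_Ioi_pos (integrableOn_one_sub_exp_neg_mul_rpow hK0 hK1) (fun u hu => ?_)
        fun u hu => ?_
      · refine mul_nonneg (sub_nonneg.2 ?_) (Real.rpow_nonneg hu.le _)
        exact Real.exp_le_one_iff.2 (neg_nonpos.2 hu.le)
      · have hu0 : 0 < u := by linarith [hu.1]
        refine mul_pos (sub_pos.2 ?_) (Real.rpow_pos_of_pos hu0 _)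
        exact Real.exp_lt_one_iff.2 (neg_lt_zero.2 hu0)
    -- The lower bound `u g(0) e^{-u g(0)}` integrated against `u^(-1-K)`, in Gamma-integral form;
    -- it converges at `0` because `K < 1`.
    set D : ℝ := ∫ u in Set.Ioi (0 : ℝ), g 0 * (u ^ (1 - K - 1) * Real.exp (-(g 0 * u)))
    have hD : 0 < D := by
      simp only [D]
      rw [integral_const_mul, Real.integral_rpow_mul_exp_neg_mul_Ioi (by linarith) hg0]
      have := Real.Gamma_pos_of_pos (show 0 < 1 - K by linarith)
      positivity
    refine ⟨D / C, div_pos hD hC, fun J _ x a hx hx0 ha => ?_⟩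
    rw [div_le_iff₀ hC]
    set X : Option J → Option J → ℝ := fun i j => |x i| ^ α + |x j| ^ α
    set Y : Option J → Option J → ℝ := fun i j => |x i - x j| ^ α
    have hX : ∀ i j, 0 ≤ X i j := fun i j => by positivity
    have hY : ∀ i j, 0 ≤ Y i j := fun i j => by positivity
    have hint : ∀ i j, IntegrableOn (fun u => a i * a j *
        ((1 - Real.exp (-(X i j * u))) * u ^ (-1 - K)
          - (1 - Real.exp (-(Y i j * u))) * u ^ (-1 - K))) (Set.Ioi 0) := fun i j =>
      ((integrableOn_one_sub_exp_neg_mul hK0 hK1 (hX i j)).sub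
        (integrableOn_one_sub_exp_neg_mul hK0 hK1 (hY i j))).const_mul _
    have hI : (∑ i, ∑ j, a i * a j * ((|x i| ^ α + |x j| ^ α) ^ K - |x i - x j| ^ (α * K))) * C =
        ∫ u in Set.Ioi (0 : ℝ), ∑ i, ∑ j, a i * a j *
          ((1 - Real.exp (-(X i j * u))) * u ^ (-1 - K)
            - (1 - Real.exp (-(Y i j * u))) * u ^ (-1 - K)) := by
      rw [integral_finsetSum _ fun i _ => integrable_finsetSum _ fun j _ => hint i j,
        Finset.sum_mul]
      refine Finset.sum_congr rfl fun i _ => ?_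
      rw [integral_finsetSum _ fun j _ => hint i j, Finset.sum_mul]
      refine Finset.sum_congr rfl fun j _ => ?_
      rw [integral_const_mul, integral_sub (integrableOn_one_sub_exp_neg_mul hK0 hK1 (hX i j))
        (integrableOn_one_sub_exp_neg_mul hK0 hK1 (hY i j)),
        integral_one_sub_exp_neg_mul hK0 (hX i j), integral_one_sub_exp_neg_mul hK0 (hY i j),
        Real.rpow_mul (abs_nonneg _)]
      ring
    rw [hI]
    refine integral_mono_of_nonneg ?_
      (integrable_finsetSum _ fun i _ => integrable_finsetSum _ fun j _ => hint i j) ?_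
    · filter_upwards [ae_restrict_mem measurableSet_Ioi] with u (hu : 0 < u)
      show 0 ≤ g 0 * (u ^ (1 - K - 1) * Real.exp (-(g 0 * u)))
      positivity
    · filter_upwards [ae_restrict_mem measurableSet_Ioi] with u (hu : 0 < u)
      have h := mul_le_mul_of_nonneg_right
        (mul_exp_le_sum_sum_exp_neg_sub hα0 hgs hg hx hx0 hu.le ha)
        (Real.rpow_nonneg hu.le (-1 - K))
      refine le_trans (le_of_eq ?_) (h.trans_eq ?_)
      · rw [show 1 - K - 1 = 1 + (-1 - K) by ring, Real.rpow_add hu, Real.rpow_one, mul_comm u (g 0)]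
        ring
      · rw [Finset.sum_mul]
        refine Finset.sum_congr rfl fun i _ => ?_
        rw [Finset.sum_mul]
        refine Finset.sum_congr rfl fun j _ => ?_
        simp only [X, Y]
        ring
  · refine ⟨g 0, hg0, fun J _ x a hx hx0 ha => ?_⟩
    simp only [mul_one, Real.rpow_one]
    -- At `K = 1` the target form is the derivative at `u = 0` of the conditioned exponential form,
    -- which vanishes there.
    have hexp : ∀ c : ℝ, HasDerivAt (fun u => Real.exp (-(c * u))) (-c) 0 := fun c => by
      simpa using ((hasDerivAt_id (0 : ℝ)).const_mul c).neg.exp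
    have hQ : HasDerivAt (fun u => ∑ i, ∑ j, a i * a j * (Real.exp (-(|x i - x j| ^ α * u))
        - Real.exp (-((|x i| ^ α + |x j| ^ α) * u))))
        (∑ i, ∑ j, a i * a j * (|x i| ^ α + |x j| ^ α - |x i - x j| ^ α)) 0 := by
      refine HasDerivAt.fun_sum fun i _ => HasDerivAt.fun_sum fun j _ => ?_
      refine (((hexp (|x i - x j| ^ α)).sub (hexp (|x i| ^ α + |x j| ^ α))).const_mul
        (a i * a j)).congr_deriv ?_
      ring
    have hlim : Filter.Tendsto (fun u : ℝ => g 0 * Real.exp (-(u * g 0)))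
        (nhdsWithin 0 (Set.Ioi 0)) (nhds (g 0)) := by
      have : Continuous fun u : ℝ => g 0 * Real.exp (-(u * g 0)) := by fun_prop
      simpa using (this.tendsto 0).mono_left nhdsWithin_le_nhds
    refine le_of_tendsto_of_tendsto hlim hQ.tendsto_slope_zero_right ?_
    filter_upwards [self_mem_nhdsWithin] with u (hu : 0 < u)
    have h := mul_exp_le_sum_sum_exp_neg_sub hα0 hgs hg hx hx0 hu.le ha
    simp only [zero_add, mul_zero, neg_zero, sub_self, Finset.sum_const_zero, sub_zero, smul_eq_mul]
    rw [le_inv_mul_iff₀ hu]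
    linarith

/-! ### Scaling and conclusion -/

/-- The kernel is homogeneous of degree `α * K`, so dilation by `2 / r` reduces distance `r` to
distance `2`. -/
theorem exists_le_sum_sum_bifractional {α K : ℝ} (hα0 : 0 < α) (hα2 : α < 2) (hK0 : 0 < K)
    (hK1 : K ≤ 1) :
    ∃ κ : ℝ, 0 < κ ∧ ∀ (J : Type) [Fintype J] (x a : Option J → ℝ) (r : ℝ), 0 < r →
      (∀ j, r ≤ |x none - x (some j)|) → r ≤ |x none| → a none = 1 →
      κ * r ^ (α * K) ≤
        ∑ i, ∑ j, a i * a j * ((|x i| ^ α + |x j| ^ α) ^ K - |x i - x j| ^ (α * K)) := by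
  obtain ⟨κ, hκ, h⟩ := exists_le_sum_sum_of_two_le hα0 hα2 hK0 hK1
  refine ⟨κ / 2 ^ (α * K), by positivity, fun J _ x a r hr hx hx0 ha => ?_⟩
  have hl : 0 < 2 / r := by positivity
  have hscale : ∀ z, r ≤ |z| → 2 ≤ |2 / r * z| := fun z hz => by
    rw [abs_mul, abs_of_pos hl, div_mul_eq_mul_div, le_div_iff₀ hr]
    linarith
  have h1 := h J (fun i => 2 / r * x i) a
    (fun j => by rw [← mul_sub]; exact hscale _ (hx j)) (hscale _ hx0) ha
  have e : ∀ i j, (|2 / r * x i| ^ α + |2 / r * x j| ^ α) ^ K - |2 / r * x i - 2 / r * x j| ^ (α * K)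
      = (2 / r) ^ (α * K) * ((|x i| ^ α + |x j| ^ α) ^ K - |x i - x j| ^ (α * K)) := by
    intro i j
    rw [← mul_sub, abs_mul, abs_mul, abs_mul, abs_of_pos hl, Real.mul_rpow hl.le (abs_nonneg _),
      Real.mul_rpow hl.le (abs_nonneg _), Real.mul_rpow hl.le (abs_nonneg _), ← mul_add,
      Real.mul_rpow (by positivity) (by positivity), ← Real.rpow_mul hl.le, mul_sub]
  simp only [e, mul_left_comm _ ((2 / r) ^ (α * K)), ← Finset.mul_sum] at h1
  rw [Real.div_rpow zero_le_two hr.le] at h1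
  have hrp := Real.rpow_pos_of_pos hr (α * K)
  rw [div_mul_eq_mul_div, div_le_iff₀ (by positivity), mul_comm _ ((2 : ℝ) ^ _)]
  rwa [div_mul_eq_mul_div, le_div_iff₀ hrp] at h1

/-- Strong local nondeterminism of bi-fractional Brownian motion. The constant `κ` depends only
on `H₀` and `K₀`; as `1 ≤ m`, the infimum over `Fin m` is a minimum. -/
theorem corollaryA2 (H₀ K₀ : ℝ) (hH₀ : 0 < H₀ ∧ H₀ < 1) (hK₀ : 0 < K₀ ∧ K₀ ≤ 1) :
    ∃ κ : ℝ, 0 < κ ∧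
      ∀ (Ω : Type*) [MeasurableSpace Ω] (P : Measure Ω) [IsProbabilityMeasure P]
        (B : ℝ≥0 → Ω → ℝ), IsBifractionalBrownianMotion H₀ K₀ B P →
      ∀ (m : ℕ), 1 ≤ m → ∀ (s : Fin m → ℝ≥0) (t : ℝ≥0),
        (∀ j, 0 < s j) → Monotone s → (∀ j, s j < t) →
        ∀ᵐ ω ∂P, κ * ⨅ j, |(t : ℝ) - (s j : ℝ)| ^ (2 * H₀ * K₀) ≤
          Var[B t; P | sigmaGenerated (fun j => B (s j))] ω := by
  obtain ⟨κ, hκ, hform⟩ := exists_le_sum_sum_bifractional (α := 2 * H₀) (K := K₀)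
    (by linarith [hH₀.1]) (by linarith [hH₀.2]) hK₀.1 hK₀.2
  refine ⟨1 / 2 ^ K₀ * κ, by positivity, fun Ω _ P _ B hB m hm s t _ _ hst => ?_⟩
  obtain ⟨c, hc⟩ := hB.isGaussianProcess.exists_condVar_ae_eq hB.measurable hB.centered s t
  filter_upwards [hc] with ω hω
  rw [hω]
  have : Nonempty (Fin m) := ⟨⟨0, hm⟩⟩
  obtain ⟨j₀, hj₀⟩ := Finite.exists_min fun j => |(t : ℝ) - (s j : ℝ)|
  have hpos : 0 < |(t : ℝ) - (s j₀ : ℝ)| :=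
    abs_pos.2 (sub_ne_zero.2 (NNReal.coe_injective.ne (hst j₀).ne'))
  -- The auxiliary point `0` is no closer to `t` than the nearest observation, so it costs nothing
  -- in the minimum.
  have hle : |(t : ℝ) - (s j₀ : ℝ)| ≤ |(t : ℝ)| := by
    have h1 : (s j₀ : ℝ) ≤ t := NNReal.coe_le_coe.2 (hst j₀).le
    rw [abs_of_nonneg (sub_nonneg.2 h1), NNReal.abs_eq]
    linarith [(s j₀).2]
  set τ : Option (Fin m) → ℝ≥0 := fun i => i.elim t s with hτ
  set a : Option (Fin m) → ℝ := fun i => i.elim 1 fun j => -c j with ha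
  have hvar : ∫ ω, (B t ω - ∑ j, c j * B (s j) ω) ^ 2 ∂P = 1 / 2 ^ K₀ * ∑ i, ∑ j, a i * a j *
      ((|(τ i : ℝ)| ^ (2 * H₀) + |(τ j : ℝ)| ^ (2 * H₀)) ^ K₀
        - |(τ i : ℝ) - τ j| ^ (2 * H₀ * K₀)) := by
    have h1 : ∀ ω, B t ω - ∑ j, c j * B (s j) ω = ∑ i, a i * B (τ i) ω := fun ω => by
      simp [Fintype.sum_option, ha, hτ, sub_eq_add_neg]
    simp_rw [h1]
    rw [integral_sum_mul_sq fun i => (hB.isGaussianProcess.hasGaussianLaw_eval (τ i)).memLp_two,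
      Finset.mul_sum]
    refine Finset.sum_congr rfl fun i _ => ?_
    rw [Finset.mul_sum]
    refine Finset.sum_congr rfl fun j _ => ?_
    rw [hB.covariance, NNReal.abs_eq, NNReal.abs_eq, abs_sub_comm (τ j : ℝ)]
    ring
  rw [hvar, mul_assoc]
  refine mul_le_mul_of_nonneg_left ?_ (by positivity)
  refine le_trans ?_ (hform (Fin m) (fun i => τ i) a _ hpos hj₀ hle rfl)
  exact mul_le_mul_of_nonneg_left
    (ciInf_le (f := fun j => |(t : ℝ) - (s j : ℝ)| ^ (2 * H₀ * K₀)) (Set.finite_range _).bddBelow j₀)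
    hκ.le
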